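/- Let $n\ge 0$ be an integer and let $S\subset GL(n+1,\mathbb{R})$ be a nonempty subsemigroup (a nonempty subset closed under multiplication). Let $\|\cdot\|$ be the Euclidean norm on $\mathbb{R}^{n+1}$, let $\mathbb{S}^n$ be its unit sphere, and let $GL(n+1,\mathbb{R})$ act on $\mathbb{S}^n$ by $(T,x)\mapsto \overline{T}(x)=T(x)/\|T(x)\|$. Let $D=\{r\,\mathrm{Id}\mid r\in\mathbb{R}\setminus\{0\}\}$, the centre of $GL(n+1,\mathbb{R})$, and give $GL(n+1,\mathbb{R})/D$ the quotient topology. Then the following are equivalent: (a) $S$ acts distally on $\mathbb{S}^n$, that is, for all $x\ne y$ in $\mathbb{S}^n$ the closure of $\{(\overline{T}(x),\overline{T}(y))\mid T\in S\}$ in $\mathbb{S}^n\times\mathbb{S}^n$ does not meet the diagonal $\{(d,d)\mid d\in\mathbb{S}^n\}$. (b) The closure of $SD/D$ in $GL(n+1,\mathbb{R})/D$ is a compact group (that is, it is compact and is a subgroup). (c) For the semigroup $S'=\{\,|\det T|^{-1/(n+1)}\,T\mid T\in S\,\}$, the closure of $S'$ in $GL(n+1,\mathbb{R})$ is a compact group.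 -/

import Mathlib

open scoped MatrixGroups

/-- A subsemigroup `S` of a group `G` acting on a topological space `X` by homeomorphisms acts
*distally* if for all `x ≠ y` in `X` the closure in `X × X` of `{(T x, T y) | T ∈ S}` does not
meet the diagonal. -/
def ActsDistally {G : Type*} (X : Type*) [Group G] [TopologicalSpace X] [MulAction G X]
    [ContinuousConstSMul G X] (S : Subsemigroup G) : Prop :=
  ∀ x y : X, x ≠ y →
    Disjoint (closure {p : X × X | ∃ T ∈ S, p = (T • x, T • y)}) (Set.diagonal X)

/-- A subset of a topological group is a compact group: it is compact and is (the underlying set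
of) a subgroup. -/
def IsCompactSubgroup {G : Type*} [Group G] [TopologicalSpace G] (A : Set G) : Prop :=
  IsCompact A ∧ ∃ H : Subgroup G, (H : Set G) = A

/-- The unit sphere `S^n` of `ℝ^(n+1)` with its Euclidean norm. -/
abbrev UnitSphere (n : ℕ) : Type :=
  Metric.sphere (0 : EuclideanSpace ℝ (Fin (n + 1))) 1

/-- The linear action of a matrix `T` on `ℝ^(n+1)`. -/
noncomputable def linAct {n : ℕ} (T : GL (Fin (n + 1)) ℝ) :
    EuclideanSpace ℝ (Fin (n + 1)) →L[ℝ] EuclideanSpace ℝ (Fin (n + 1)) :=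
  Matrix.toEuclideanCLM (𝕜 := ℝ) (T : Matrix (Fin (n + 1)) (Fin (n + 1)) ℝ)

theorem linAct_one {n : ℕ} (x : EuclideanSpace ℝ (Fin (n + 1))) :
    linAct (1 : GL (Fin (n + 1)) ℝ) x = x := by
  simp [linAct]

theorem linAct_mul {n : ℕ} (T U : GL (Fin (n + 1)) ℝ) (x : EuclideanSpace ℝ (Fin (n + 1))) :
    linAct (T * U) x = linAct T (linAct U x) := by
  simp [linAct]

theorem linAct_ne_zero {n : ℕ} (T : GL (Fin (n + 1)) ℝ) (x : UnitSphere n) :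
    linAct T (x : EuclideanSpace ℝ (Fin (n + 1))) ≠ 0 := by
  intro h
  have h1 : linAct (T⁻¹ * T) (x : EuclideanSpace ℝ (Fin (n + 1))) = 0 := by
    rw [linAct_mul, h, map_zero]
  rw [inv_mul_cancel, linAct_one] at h1
  exact ne_zero_of_mem_unit_sphere x h1

/-- The map `x ↦ T x / ‖T x‖` of the unit sphere. -/
noncomputable def sphereMap {n : ℕ} (T : GL (Fin (n + 1)) ℝ) (x : UnitSphere n) :
    UnitSphere n :=
  ⟨‖linAct T (x : EuclideanSpace ℝ (Fin (n + 1)))‖⁻¹ •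
      linAct T (x : EuclideanSpace ℝ (Fin (n + 1))), by
    have h := norm_ne_zero_iff.mpr (linAct_ne_zero T x)
    rw [mem_sphere_zero_iff_norm, norm_smul, norm_inv, norm_norm, inv_mul_cancel₀ h]⟩

/-- The action of `GL(n+1,ℝ)` on `S^n` by `T • x = T x / ‖T x‖`. -/
noncomputable instance sphereMulAction (n : ℕ) :
    MulAction (GL (Fin (n + 1)) ℝ) (UnitSphere n) where
  smul T x := sphereMap T x
  one_smul x := by
    apply Subtype.ext
    change ‖linAct 1 (x : EuclideanSpace ℝ (Fin (n + 1)))‖⁻¹ • linAct 1 _ = _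
    rw [linAct_one, norm_eq_of_mem_sphere x, inv_one, one_smul]
  mul_smul T U x := by
    have h := norm_ne_zero_iff.mpr (linAct_ne_zero U x)
    apply Subtype.ext
    change ‖linAct (T * U) (x : EuclideanSpace ℝ (Fin (n + 1)))‖⁻¹ • linAct (T * U) _ =
      ‖linAct T (‖linAct U (x : EuclideanSpace ℝ (Fin (n + 1)))‖⁻¹ • linAct U _)‖⁻¹ •
        linAct T (‖linAct U (x : EuclideanSpace ℝ (Fin (n + 1)))‖⁻¹ • linAct U _)
    rw [map_smul, norm_smul, norm_inv, norm_norm, smul_smul, mul_inv, inv_inv, linAct_mul,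
      mul_right_comm, mul_inv_cancel₀ h, one_mul]

/-- Each `T` acts on `S^n` as a homeomorphism. -/
instance sphereContinuousConstSMul (n : ℕ) :
    ContinuousConstSMul (GL (Fin (n + 1)) ℝ) (UnitSphere n) where
  continuous_const_smul T := by
    change Continuous (sphereMap T)
    unfold sphereMap
    have hc : Continuous fun x : UnitSphere n =>
        linAct T (x : EuclideanSpace ℝ (Fin (n + 1))) :=
      (linAct T).continuous.comp continuous_subtype_val
    exact ((hc.norm.inv₀ fun x => norm_ne_zero_iff.mpr (linAct_ne_zero T x)).smul hc).subtype_mk _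

/-- The group `D` of nonzero scalar matrices in `GL(n+1,ℝ)`. -/
def scalarMatrices (n : ℕ) : Subgroup (GL (Fin (n + 1)) ℝ) :=
  (Matrix.GeneralLinearGroup.scalar (R := ℝ) (Fin (n + 1))).range

theorem scalarMatrices_eq_center (n : ℕ) :
    scalarMatrices n = Subgroup.center (GL (Fin (n + 1)) ℝ) :=
  Matrix.GeneralLinearGroup.center_eq_range_scalar.symm

instance scalarMatrices_normal (n : ℕ) : (scalarMatrices n).Normal := by
  rw [scalarMatrices_eq_center]
  infer_instance

/-- The image `SD/D` of a semigroup `S` in `GL(n+1,ℝ)/D`. -/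
def projectiveImage {n : ℕ} (S : Subsemigroup (GL (Fin (n + 1)) ℝ)) :
    Set (GL (Fin (n + 1)) ℝ ⧸ scalarMatrices n) :=
  {q | ∃ T ∈ S, q = (T : GL (Fin (n + 1)) ℝ ⧸ scalarMatrices n)}

/-- The number `α_T = |det T|^(-1/(n+1))`, a nonzero real. -/
noncomputable def normFactor {n : ℕ} (T : GL (Fin (n + 1)) ℝ) : ℝˣ :=
  Units.mk0 (|(T : Matrix (Fin (n + 1)) (Fin (n + 1)) ℝ).det| ^ (-1 / ((n : ℝ) + 1)))
    (Real.rpow_pos_of_pos (abs_pos.mpr T.det_ne_zero) _).ne'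

/-- The normalized semigroup `S' = {α_T T | T ∈ S}`. -/
noncomputable def normalizedSemigroup {n : ℕ} (S : Subsemigroup (GL (Fin (n + 1)) ℝ)) :
    Set (GL (Fin (n + 1)) ℝ) :=
  {U | ∃ T ∈ S, U = Matrix.GeneralLinearGroup.scalar (Fin (n + 1)) (normFactor T) * T}

/-!
The implications (c) ⇒ (a) and (c) ⇒ (b) are soft: a compact group `K` containing the normalized
semigroup acts on the sphere by bijections, so `{(T x, T y) | T ∈ K}` is a compact set off the
diagonal when `x ≠ y`, and the image of `K` in the Hausdorff quotient `GL(n+1,ℝ)/D` is a compact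
group in which `SD/D` is dense.

For the converses, a compact nonempty subsemigroup of a Hausdorff topological group is a group
(`isCompactSubgroup_of_mul_mem`: an idempotent of `x K` yields the inverse of `x`), and a set of
matrices with `|det| = 1` and bounded operator norm is relatively compact in `GL(n+1,ℝ)`. Hence (c)
amounts to a norm bound on the normalized semigroup (`isCompactSubgroup_of_bounded`).

* Under (b) the bound holds because `T ↦ ‖α_T T‖` is continuous and descends to `GL(n+1,ℝ)/D`.
* Under (a), suppose `T_k ∈ S` with `‖α_{T_k} T_k‖ → ∞`. A limit point `B` of `T_k / ‖T_k‖` has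
  norm one, and `det B = 0` because `|det (α_{T_k} T_k)| = 1`. Choose `v` with `B v ≠ 0` and
  `w ≠ 0` in the kernel of `B`. The directions of `v` and `v + w` are distinct points of the
  sphere, and both are sent by `T_k` to sequences converging to the direction of `B v`, which
  contradicts distality.
-/

open Filter Topology NormedSpace

/-! ### Compact subsemigroups of topological groups -/

theorem isCompactSubgroup_of_mul_mem {G : Type*} [Group G] [TopologicalSpace G]
    [IsTopologicalGroup G] [T2Space G] {A : Set G} (hA : IsCompact A) (hne : A.Nonempty)
    (hmul : ∀ x ∈ A, ∀ y ∈ A, x * y ∈ A) : IsCompactSubgroup A := by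
  have key : ∀ x ∈ A, x⁻¹ ∈ A := by
    intro x hx
    -- The idempotent of the compact semigroup `x A` is the identity of the group.
    obtain ⟨m, ⟨a, ha, rfl⟩, hm⟩ := exists_idempotent_in_compact_subsemigroup
      (fun r : G => continuous_mul_const r) ((x * ·) '' A) (hne.image _)
      (hA.image (continuous_const_mul x)) (by
        rintro _ ⟨a, ha, rfl⟩ _ ⟨b, hb, rfl⟩
        exact ⟨a * (x * b), hmul _ ha _ (hmul _ hx _ hb), by simp only [mul_assoc]⟩)
    have h1 : x * a = 1 := mul_eq_left.mp hm
    rwa [inv_eq_of_mul_eq_one_right h1]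
  obtain ⟨x, hx⟩ := hne
  exact ⟨hA, { carrier := A
               mul_mem' := fun ha hb => hmul _ ha _ hb
               one_mem' := mul_inv_cancel x ▸ hmul _ hx _ (key x hx)
               inv_mem' := fun ha => key _ ha }, rfl⟩

/-! ### The operator norm and compactness in the general linear group -/

section

variable {n : ℕ}

/-- Matrices as continuous linear maps of Euclidean space, as a linear homeomorphism. -/
noncomputable def matrixEquivCLM (n : ℕ) : Matrix (Fin (n + 1)) (Fin (n + 1)) ℝ ≃L[ℝ]
    (EuclideanSpace ℝ (Fin (n + 1)) →L[ℝ] EuclideanSpace ℝ (Fin (n + 1))) :=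
  LinearEquiv.toContinuousLinearEquiv
    (Matrix.toEuclideanCLM (𝕜 := ℝ) (n := Fin (n + 1))).toAlgEquiv.toLinearEquiv

theorem linAct_eq_matrixEquivCLM (T : GL (Fin (n + 1)) ℝ) :
    linAct T = matrixEquivCLM n (T : Matrix (Fin (n + 1)) (Fin (n + 1)) ℝ) := rfl

theorem continuous_linAct : Continuous (linAct (n := n)) :=
  (matrixEquivCLM n).continuous.comp Units.continuous_val

theorem linAct_scalar_mul (c : ℝˣ) (T : GL (Fin (n + 1)) ℝ) :
    linAct (Matrix.GeneralLinearGroup.scalar (Fin (n + 1)) c * T) = (c : ℝ) • linAct T := by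
  rw [linAct_eq_matrixEquivCLM, linAct_eq_matrixEquivCLM, ← map_smul]
  congr 1
  rw [Units.val_mul, Matrix.GeneralLinearGroup.coe_scalar, Matrix.scalar_apply,
    Matrix.smul_eq_diagonal_mul]

/-- The bounds make the set relatively compact among all matrices, and since the inverse of a
matrix with `|det| = 1` is `± adjugate`, also relatively compact in the group. -/
theorem isCompact_closure_of_bounded {A : Set (GL (Fin (n + 1)) ℝ)} {C : ℝ}
    (hdet : ∀ T ∈ A, |(T : Matrix (Fin (n + 1)) (Fin (n + 1)) ℝ).det| = 1)
    (hC : ∀ T ∈ A, ‖linAct T‖ ≤ C) : IsCompact (closure A) := by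
  have : ProperSpace
      (EuclideanSpace ℝ (Fin (n + 1)) →L[ℝ] EuclideanSpace ℝ (Fin (n + 1))) :=
    FiniteDimensional.proper ℝ _
  let M : Set (Matrix (Fin (n + 1)) (Fin (n + 1)) ℝ) :=
    (matrixEquivCLM n).symm '' Metric.closedBall 0 C ∩ {B | |B.det| = 1}
  have hM : IsCompact M :=
    ((isCompact_closedBall _ _).image (matrixEquivCLM n).symm.continuous).inter_right
      (isClosed_eq (continuous_id.matrix_det.abs) continuous_const)
  have hsq : ∀ B ∈ M, B.det * B.det = 1 := fun B hB => by
    rw [← abs_mul_abs_self, show |B.det| = 1 from hB.2, one_mul]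
  let u : M → GL (Fin (n + 1)) ℝ := fun B =>
    { val := B.1
      inv := B.1.det • B.1.adjugate
      val_inv := by rw [Matrix.mul_smul, Matrix.mul_adjugate, smul_smul, hsq _ B.2, one_smul]
      inv_val := by rw [Matrix.smul_mul, Matrix.adjugate_mul, smul_smul, hsq _ B.2, one_smul] }
  have hu : Continuous u := Units.continuous_iff.mpr
    ⟨continuous_subtype_val,
      continuous_subtype_val.matrix_det.smul continuous_subtype_val.matrix_adjugate⟩
  have := isCompact_iff_compactSpace.mp hM
  refine (isCompact_range hu).closure_of_subset fun T hT => ?_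
  refine ⟨⟨T, ⟨linAct T, by simpa using hC T hT, ?_⟩, hdet T hT⟩, Units.ext rfl⟩
  rw [linAct_eq_matrixEquivCLM, ContinuousLinearEquiv.symm_apply_apply]

/-! ### Normalization of the determinant -/

theorem normFactor_pos (T : GL (Fin (n + 1)) ℝ) : 0 < (normFactor T : ℝ) :=
  Real.rpow_pos_of_pos (abs_pos.mpr T.det_ne_zero) _

theorem normFactor_mul (T U : GL (Fin (n + 1)) ℝ) :
    normFactor (T * U) = normFactor T * normFactor U := by
  apply Units.ext
  simp only [normFactor, Units.val_mul, Units.val_mk0, Matrix.det_mul, abs_mul]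
  exact Real.mul_rpow (abs_nonneg _) (abs_nonneg _)

theorem continuous_normFactor : Continuous fun T : GL (Fin (n + 1)) ℝ => (normFactor T : ℝ) :=
  Continuous.rpow_const (Units.continuous_val.matrix_det.abs)
    fun T => Or.inl (abs_pos.mpr T.det_ne_zero).ne'

theorem normFactor_scalar (c : ℝˣ) :
    (normFactor (Matrix.GeneralLinearGroup.scalar (Fin (n + 1)) c) : ℝ) = |(c : ℝ)|⁻¹ := by
  have hc : 0 < |(c : ℝ)| := abs_pos.mpr c.ne_zero
  have hn : (n : ℝ) + 1 ≠ 0 := by positivity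
  simp only [normFactor, Units.val_mk0, Matrix.GeneralLinearGroup.coe_scalar, Matrix.scalar_apply,
    Matrix.det_diagonal, Finset.prod_const, Finset.card_univ, Fintype.card_fin, abs_pow]
  rw [← Real.rpow_natCast, ← Real.rpow_mul hc.le, Nat.cast_add, Nat.cast_one,
    mul_div_cancel₀ _ hn, Real.rpow_neg_one]

/-- The matrix `α_T T`, which spans the same line as `T` and has determinant `±1`. -/
noncomputable def normalizeDet (T : GL (Fin (n + 1)) ℝ) : GL (Fin (n + 1)) ℝ :=
  Matrix.GeneralLinearGroup.scalar (Fin (n + 1)) (normFactor T) * T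

theorem normalizeDet_mul (T U : GL (Fin (n + 1)) ℝ) :
    normalizeDet (T * U) = normalizeDet T * normalizeDet U := by
  rw [normalizeDet, normalizeDet, normalizeDet, normFactor_mul, map_mul, mul_assoc, mul_assoc,
    ← mul_assoc _ T, Matrix.GeneralLinearGroup.scalar_commute _ T, mul_assoc]

theorem linAct_normalizeDet (T : GL (Fin (n + 1)) ℝ) :
    linAct (normalizeDet T) = (normFactor T : ℝ) • linAct T := linAct_scalar_mul _ _

theorem abs_det_normalizeDet (T : GL (Fin (n + 1)) ℝ) :
    |(normalizeDet T : Matrix (Fin (n + 1)) (Fin (n + 1)) ℝ).det| = 1 := by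
  have hd : 0 < |(T : Matrix (Fin (n + 1)) (Fin (n + 1)) ℝ).det| := abs_pos.mpr T.det_ne_zero
  have hn : (n : ℝ) + 1 ≠ 0 := by positivity
  simp only [normalizeDet, Units.val_mul, Matrix.GeneralLinearGroup.coe_scalar,
    Matrix.scalar_apply, Matrix.det_mul, Matrix.det_diagonal, Finset.prod_const, Finset.card_univ,
    Fintype.card_fin, abs_mul, abs_pow, abs_of_pos (normFactor_pos T)]
  simp only [normFactor, Units.val_mk0]
  rw [← Real.rpow_natCast, ← Real.rpow_mul hd.le, Nat.cast_add, Nat.cast_one,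
    div_mul_cancel₀ _ hn, Real.rpow_neg_one, inv_mul_cancel₀ hd.ne']

theorem coe_normalizeDet (T : GL (Fin (n + 1)) ℝ) :
    (normalizeDet T : GL (Fin (n + 1)) ℝ ⧸ scalarMatrices n) = T := by
  have h : Matrix.GeneralLinearGroup.scalar (Fin (n + 1)) (normFactor T) ∈ scalarMatrices n :=
    MonoidHom.mem_range.mpr ⟨_, rfl⟩
  rw [normalizeDet, QuotientGroup.mk_mul, (QuotientGroup.eq_one_iff _).mpr h, one_mul]

/-- A bound on the operator norms of the normalized semigroup is enough for its closure to be a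
compact group. -/
theorem isCompactSubgroup_of_bounded {S : Subsemigroup (GL (Fin (n + 1)) ℝ)}
    (hS : (S : Set (GL (Fin (n + 1)) ℝ)).Nonempty) {C : ℝ}
    (hC : ∀ T ∈ S, ‖linAct (normalizeDet T)‖ ≤ C) :
    IsCompactSubgroup (closure (normalizedSemigroup S)) := by
  let N : Subsemigroup (GL (Fin (n + 1)) ℝ) :=
    { carrier := normalizedSemigroup S
      mul_mem' := by
        rintro _ _ ⟨T, hT, rfl⟩ ⟨U, hU, rfl⟩
        exact ⟨T * U, S.mul_mem hT hU, (normalizeDet_mul T U).symm⟩ }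
  obtain ⟨T, hT⟩ := hS
  refine isCompactSubgroup_of_mul_mem (isCompact_closure_of_bounded (C := C) ?_ ?_)
    ⟨_, subset_closure ⟨T, hT, rfl⟩⟩
    fun x hx y hy => N.topologicalClosure.mul_mem (show x ∈ N.topologicalClosure from hx) hy
  · rintro _ ⟨T, -, rfl⟩
    exact abs_det_normalizeDet T
  · rintro _ ⟨T, hT, rfl⟩
    exact hC T hT

/-! ### Compactness in the quotient by scalars -/

theorem norm_linAct_normalizeDet_mul_of_mem (T : GL (Fin (n + 1)) ℝ)
    {d : GL (Fin (n + 1)) ℝ} (hd : d ∈ scalarMatrices n) :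
    ‖linAct (normalizeDet (T * d))‖ = ‖linAct (normalizeDet T)‖ := by
  obtain ⟨c, rfl⟩ := MonoidHom.mem_range.mp hd
  have hc : |(c : ℝ)| ≠ 0 := abs_ne_zero.mpr c.ne_zero
  rw [linAct_normalizeDet, linAct_normalizeDet, normFactor_mul, Units.val_mul, normFactor_scalar,
    ← Matrix.GeneralLinearGroup.scalar_commute, linAct_scalar_mul, smul_smul, norm_smul, norm_smul,
    norm_mul, norm_mul, norm_inv, Real.norm_eq_abs |_|, abs_abs, Real.norm_eq_abs (c : ℝ),
    inv_mul_cancel_right₀ hc]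

/-- `T ↦ ‖α_T T‖` is a continuous function on `GL(n+1,ℝ)/D`, hence bounded on compact sets. -/
theorem bounded_of_isCompact_projectiveImage {S : Subsemigroup (GL (Fin (n + 1)) ℝ)}
    (h : IsCompact (closure (projectiveImage S))) :
    ∃ C, ∀ T ∈ S, ‖linAct (normalizeDet T)‖ ≤ C := by
  let f : GL (Fin (n + 1)) ℝ ⧸ scalarMatrices n → ℝ :=
    Quotient.lift (fun T => ‖linAct (normalizeDet T)‖) fun T U hTU => by
      have := norm_linAct_normalizeDet_mul_of_mem T (QuotientGroup.leftRel_apply.mp hTU)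
      rw [mul_inv_cancel_left] at this
      exact this.symm
  have hf : Continuous f := by
    refine continuous_quot_lift _ ?_
    simp_rw [linAct_normalizeDet]
    exact (continuous_normFactor.smul continuous_linAct).norm
  obtain ⟨C, hC⟩ := (h.image hf).bddAbove
  exact ⟨C, fun T hT => hC ⟨T, subset_closure ⟨T, hT, rfl⟩, rfl⟩⟩

theorem isCompactSubgroup_projectiveImage {S : Subsemigroup (GL (Fin (n + 1)) ℝ)}
    (h : IsCompactSubgroup (closure (normalizedSemigroup S))) :
    IsCompactSubgroup (closure (projectiveImage S)) := by
  have : IsClosed (scalarMatrices n : Set (GL (Fin (n + 1)) ℝ)) := by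
    rw [scalarMatrices_eq_center, Subgroup.coe_center, ← Set.centralizer_univ]
    exact Set.isClosed_centralizer _
  obtain ⟨hK, H, hH⟩ := h
  have himg : projectiveImage S = QuotientGroup.mk' (scalarMatrices n) '' normalizedSemigroup S := by
    ext q
    constructor
    · rintro ⟨T, hT, rfl⟩
      exact ⟨_, ⟨T, hT, rfl⟩, coe_normalizeDet T⟩
    · rintro ⟨_, ⟨T, hT, rfl⟩, rfl⟩
      exact ⟨T, hT, coe_normalizeDet T⟩
  have hq : Continuous (QuotientGroup.mk' (scalarMatrices n)) := QuotientGroup.continuous_mk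
  rw [himg, ← image_closure_of_isCompact hK hq.continuousOn]
  exact ⟨hK.image hq, H.map (QuotientGroup.mk' (scalarMatrices n)), by
    rw [Subgroup.coe_map, hH]⟩

/-! ### Distality on the sphere -/

theorem coe_smul_sphere (T : GL (Fin (n + 1)) ℝ) (x : UnitSphere n) :
    ((T • x : UnitSphere n) : EuclideanSpace ℝ (Fin (n + 1))) = normalize (linAct T x) := rfl

theorem normalizeDet_smul_sphere (T : GL (Fin (n + 1)) ℝ) (x : UnitSphere n) :
    normalizeDet T • x = T • x := by
  apply Subtype.ext
  rw [coe_smul_sphere, coe_smul_sphere, linAct_normalizeDet, smul_apply,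
    normalize_smul_of_pos (normFactor_pos T)]

theorem continuous_smul_sphere (x : UnitSphere n) :
    Continuous fun T : GL (Fin (n + 1)) ℝ => T • x := by
  have hc : Continuous fun T : GL (Fin (n + 1)) ℝ =>
      linAct T (x : EuclideanSpace ℝ (Fin (n + 1))) := continuous_linAct.clm_apply continuous_const
  exact ((hc.norm.inv₀ fun T => norm_ne_zero_iff.mpr (linAct_ne_zero T x)).smul hc).subtype_mk _

theorem actsDistally_of_isCompact {S : Subsemigroup (GL (Fin (n + 1)) ℝ)}
    (h : IsCompact (closure (normalizedSemigroup S))) : ActsDistally (UnitSphere n) S := by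
  intro x y hxy
  have hK := h.image ((continuous_smul_sphere x).prodMk (continuous_smul_sphere y))
  refine Disjoint.mono_left (closure_minimal ?_ hK.isClosed) (Set.disjoint_left.mpr ?_)
  · rintro _ ⟨T, hT, rfl⟩
    exact ⟨normalizeDet T, subset_closure ⟨T, hT, rfl⟩, by
      simp only [normalizeDet_smul_sphere]⟩
  · rintro _ ⟨T, -, rfl⟩ hd
    exact hxy (MulAction.injective T hd)

theorem tendsto_normalize {E : Type*} [NormedAddCommGroup E] [NormedSpace ℝ E] {v : E}
    (hv : v ≠ 0) : Tendsto NormedSpace.normalize (𝓝 v) (𝓝 (normalize v)) :=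
  (tendsto_id.norm.inv₀ (norm_ne_zero_iff.mpr hv)).smul tendsto_id

/-- If `T_k / ‖T_k‖` converges to `B`, then `T_k` acts on the directions outside the kernel of `B`
as `B` does, in the limit. -/
theorem tendsto_smul_sphere {T : ℕ → GL (Fin (n + 1)) ℝ}
    {B : EuclideanSpace ℝ (Fin (n + 1)) →L[ℝ] EuclideanSpace ℝ (Fin (n + 1))}
    (hB : Tendsto (fun k => ‖linAct (T k)‖⁻¹ • linAct (T k)) atTop (𝓝 B))
    {x z : UnitSphere n} (hx : B x ≠ 0) (hz : (z : EuclideanSpace ℝ (Fin (n + 1))) =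
      normalize (B x)) :
    Tendsto (fun k => T k • x) atTop (𝓝 z) := by
  rw [tendsto_subtype_rng, hz]
  refine ((tendsto_normalize hx).comp (((ContinuousLinearMap.apply ℝ _
    (x : EuclideanSpace ℝ (Fin (n + 1)))).continuous.tendsto B).comp hB)).congr fun k => ?_
  have hT : linAct (T k) ≠ 0 := fun h => linAct_ne_zero (T k) x (by rw [h]; rfl)
  exact normalize_smul_of_pos (inv_pos.mpr (norm_pos_iff.mpr hT)) _

/-- A nonzero non-injective limit `B` of `T_k / ‖T_k‖` obstructs distality: it identifies the
directions of `v` and `v + w` when `w` is in its kernel and `v` is not. -/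
theorem not_actsDistally_of_tendsto {S : Subsemigroup (GL (Fin (n + 1)) ℝ)}
    {T : ℕ → GL (Fin (n + 1)) ℝ} (hT : ∀ k, T k ∈ S)
    {B : EuclideanSpace ℝ (Fin (n + 1)) →L[ℝ] EuclideanSpace ℝ (Fin (n + 1))}
    (hB : Tendsto (fun k => ‖linAct (T k)‖⁻¹ • linAct (T k)) atTop (𝓝 B))
    (hB0 : B ≠ 0) {w : EuclideanSpace ℝ (Fin (n + 1))} (hw : w ≠ 0) (hBw : B w = 0) :
    ¬ ActsDistally (UnitSphere n) S := by
  intro hS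
  obtain ⟨v, hv⟩ : ∃ v, B v ≠ 0 := by
    by_contra! h
    exact hB0 (ContinuousLinearMap.ext h)
  have hBvw : B (v + w) = B v := by rw [map_add, hBw, add_zero]
  have hv0 : v ≠ 0 := fun h => hv (by rw [h, map_zero])
  have hvw0 : v + w ≠ 0 := fun h => hv (by rw [← hBvw, h, map_zero])
  let dir (u : EuclideanSpace ℝ (Fin (n + 1))) (hu : u ≠ 0) : UnitSphere n :=
    ⟨normalize u, mem_sphere_zero_iff_norm.mpr (norm_normalize_eq_one_iff.mpr hu)⟩
  have hBdir : ∀ u hu, B (dir u hu) = ‖u‖⁻¹ • B u := fun u hu => map_smul B _ u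
  have hlim : ∀ u hu, B u = B v → Tendsto (fun k => T k • dir u hu) atTop (𝓝 (dir (B v) hv)) := by
    intro u hu h
    have hu' : 0 < ‖u‖⁻¹ := inv_pos.mpr (norm_pos_iff.mpr hu)
    refine tendsto_smul_sphere hB ?_ ?_
    · rw [hBdir u hu, h]
      exact smul_ne_zero hu'.ne' hv
    · rw [hBdir u hu, h, normalize_smul_of_pos hu']
  have hne : dir v hv0 ≠ dir (v + w) hvw0 := by
    intro h
    -- Applying `B` to the equality shows `‖v‖ = ‖v + w‖`, so `v = v + w`.
    have h1 : normalize v = normalize (v + w) := congrArg Subtype.val h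
    have h2 : ‖v‖⁻¹ • B v = ‖v + w‖⁻¹ • B v := by
      rw [← hBdir v hv0, h, hBdir _ hvw0, hBvw]
    have h3 : ‖v‖ = ‖v + w‖ := inv_injective (smul_left_injective ℝ hv h2)
    apply hw
    rw [← add_eq_left (a := v), ← norm_smul_normalize (v + w), ← h1, ← h3, norm_smul_normalize]
  have hmem : (dir (B v) hv, dir (B v) hv) ∈
      closure {p : UnitSphere n × UnitSphere n | ∃ U ∈ S,
        p = (U • dir v hv0, U • dir (v + w) hvw0)} :=
    mem_closure_of_tendsto ((hlim v hv0 rfl).prodMk_nhds (hlim (v + w) hvw0 hBvw))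
      (Eventually.of_forall fun k => ⟨T k, hT k, rfl⟩)
  exact Set.disjoint_left.mp (hS _ _ hne) hmem rfl

theorem bounded_of_actsDistally {S : Subsemigroup (GL (Fin (n + 1)) ℝ)}
    (hS : ActsDistally (UnitSphere n) S) : ∃ C, ∀ T ∈ S, ‖linAct (normalizeDet T)‖ ≤ C := by
  by_contra! h
  have : ProperSpace
      (EuclideanSpace ℝ (Fin (n + 1)) →L[ℝ] EuclideanSpace ℝ (Fin (n + 1))) :=
    FiniteDimensional.proper ℝ _
  choose T hT hlt using fun k : ℕ => h k
  have hpos : ∀ k, 0 < ‖linAct (normalizeDet (T k))‖ := fun k => (Nat.cast_nonneg k).trans_lt (hlt k)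
  -- Positive rescaling does not change `T / ‖T‖`.
  have hscale : ∀ k, normalize (linAct (normalizeDet (T k))) = normalize (linAct (T k)) := by
    intro k
    rw [linAct_normalizeDet, normalize_smul_of_pos (normFactor_pos _)]
  obtain ⟨B, hBmem, φ, hφ, hB⟩ := (isCompact_sphere
      (0 : EuclideanSpace ℝ (Fin (n + 1)) →L[ℝ] EuclideanSpace ℝ (Fin (n + 1))) 1).tendsto_subseq
    (x := fun k => normalize (linAct (normalizeDet (T k)))) fun k =>
      mem_sphere_zero_iff_norm.mpr (norm_normalize_eq_one_iff.mpr (norm_pos_iff.mp (hpos k)))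
  have hB0 : B ≠ 0 := norm_ne_zero_iff.mp (by
    rw [mem_sphere_zero_iff_norm.mp hBmem]
    exact one_ne_zero)
  have hdet : ((matrixEquivCLM n).symm B).det = 0 := by
    have hcont : Continuous fun A => |((matrixEquivCLM n).symm A).det| :=
      (matrixEquivCLM n).symm.continuous.matrix_det.abs
    refine abs_eq_zero.mp (tendsto_nhds_unique ((hcont.tendsto B).comp hB) ?_)
    have hinf : Tendsto (fun k => ‖linAct (normalizeDet (T k))‖) atTop atTop :=
      tendsto_atTop_mono (fun k => (hlt k).le) tendsto_natCast_atTop_atTop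
    have hzero := ((tendsto_inv_atTop_zero.comp hinf).pow (n + 1)).comp hφ.tendsto_atTop
    rw [zero_pow n.succ_ne_zero] at hzero
    refine hzero.congr fun k => ?_
    simp only [Function.comp_apply, NormedSpace.normalize, map_smul,
      linAct_eq_matrixEquivCLM (normalizeDet _),
      ContinuousLinearEquiv.symm_apply_apply, Matrix.det_smul, abs_mul, abs_det_normalizeDet,
      Fintype.card_fin, abs_pow, abs_inv, abs_norm, mul_one]
  obtain ⟨w, hw, hBw⟩ := Matrix.exists_mulVec_eq_zero_iff.mpr hdet
  have hBw' : B (WithLp.toLp 2 w) = 0 := by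
    rw [← (matrixEquivCLM n).apply_symm_apply B]
    change WithLp.toLp 2 (((matrixEquivCLM n).symm B).mulVec w) = 0
    rw [hBw, WithLp.toLp_zero]
  exact not_actsDistally_of_tendsto (fun k => hT (φ k))
    (hB.congr fun k => hscale (φ k)) hB0 (by simpa using hw) hBw' hS

end

theorem theorem1 (n : ℕ) (S : Subsemigroup (GL (Fin (n + 1)) ℝ))
    (hS : (S : Set (GL (Fin (n + 1)) ℝ)).Nonempty) :
    List.TFAE
      [ActsDistally (UnitSphere n) S,
       IsCompactSubgroup (closure (projectiveImage S)),
       IsCompactSubgroup (closure (normalizedSemigroup S))] := by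
  tfae_have 1 → 3 := fun h =>
    (bounded_of_actsDistally h).elim fun _ => isCompactSubgroup_of_bounded hS
  tfae_have 2 → 3 := fun h =>
    (bounded_of_isCompact_projectiveImage h.1).elim fun _ => isCompactSubgroup_of_bounded hS
  tfae_have 3 → 1 := fun h => actsDistally_of_isCompact h.1
  tfae_have 3 → 2 := isCompactSubgroup_projectiveImage
  tfae_finish
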